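/- Let $K=\mathbb{R}$ or $K=\mathbb{C}$, let $(T,d)$ be a compact metric space with at least two points and Borel $\sigma$-algebra $\mathcal{B}$, and let $X\neq\{0\}$ be a Hilbert space over $K$ whose scalar product $(\cdot\mid\cdot)$ is linear in the first variable. Let $cabv(X)$ be the space of $\sigma$-additive measures $\mu:\mathcal{B}\to X$ with finite total variation $\|\mu\|=|\mu|(T)$. For continuous $f:T\to X$ let $\int f\,d\mu\in K$ be the integral determined by $\int \varphi_A x\,d\mu=(x\mid\mu(A))$ for $A\in\mathcal{B}$, $x\in X$ (with $\varphi_A$ the indicator function of $A$), by linearity in $f$, and by uniform limits of simple functions. The weak$^*$ topology on $cabv(X)$ is the coarsest one making all maps $\mu\mapsto\int f\,d\mu$ with $f\in C(T,X)$ continuous. For $f:T\to X$ let $\|f\|_L=\sup_{s\neq t}\|f(s)-f(t)\|/d(s,t)$, and put $$\|\mu\|_{MK}=\sup\Big\{\Big|\int f\,d\mu\Big| : \sup_{t\in T}\|f(t)\|+\|f\|_L\le 1\Big\},\qquad \|\mu\|^*_{MK}=\sup\Big\{\Big|\int f\,d\mu\Big| : \|f\|_L\le 1\Big\}$$ (the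 second one for $\mu(T)=0$), $d_{MK}(\mu,\nu)=\|\mu-\nu\|_{MK}$ and $d^*_{MK}(\mu,\nu)=\|\mu-\nu\|^*_{MK}$. For $a>0$ and $v\in X$ let $B_a(X)=\{\mu\in cabv(X):\|\mu\|\le a\}$ and $B_a(X,v)=\{\mu\in B_a(X):\mu(T)=v\}$. Theorem 20. Let $a>0$. 1. Let $v\in X$ with $\|v\|\le a$. Then $B_a(X,v)$ is non-empty, weak$^*$ closed (in $cabv(X)$ and in $B_a(X)$) and weak$^*$ compact. On $B_a(X,v)$ both $d_{MK}$ and $d^*_{MK}$ are (finite) metrics, and they are equivalent: $d_{MK}(\mu,\nu)\le d^*_{MK}(\mu,\nu)\le(\operatorname{diam}(T)+1)\,d_{MK}(\mu,\nu)$ for all $\mu,\nu\in B_a(X,v)$. 2. Let $n\ge 1$ and $X=K^n$ with its Euclidean scalar product, and let $v\in K^n$ with $\|v\|\le a$. Then $B_a(K^n,v)$, equipped with $d_{MK}$ or with $d^*_{MK}$, is a compact, hence complete, metric space whose topology is the weak$^*$ topology on $B_a(K^n,v)$. 3. Let $K=X=\mathbb{R}$ and $0\le v\le a$, and let $B_a^+(\mathbb{R},v)$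 be the set of all $\mu\in B_a(\mathbb{R},v)$ with $\mu(A)\ge 0$ for every $A\in\mathcal{B}$. Then $B_a^+(\mathbb{R},v)$, equipped with $d_{MK}$ or with $d^*_{MK}$, is a compact, hence complete, metric space whose topology is the weak$^*$ topology on $B_a^+(\mathbb{R},v)$. Moreover, $B_1^+(\mathbb{R},1)$ is exactly the set of all probability measures on $\mathcal{B}$. -/

import Mathlib

open MeasureTheory Set
open scoped ENNReal

namespace VectorMK

noncomputable section

/-- The scalar product `(x | y)` of a Hilbert space over `K`, linear in `x` and conjugate-linear
in `y`, as a continuous real-bilinear pairing. Mathlib's `inner K` is linear in its second argument,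
so `(x | y) = inner K y x`. -/
def scalarProduct (K X : Type*) [RCLike K] [NormedAddCommGroup X] [InnerProductSpace K X]
    [NormedSpace ℝ X] [IsScalarTower ℝ K X] : X →L[ℝ] X →L[ℝ] K :=
  LinearMap.mkContinuous₂
    (LinearMap.mk₂ ℝ (fun x y : X => inner K y x)
      (fun x x' y => inner_add_right y x x')
      (fun r x y => by
        rw [← algebraMap_smul K r x, inner_smul_right, Algebra.smul_def])
      (fun x y y' => inner_add_left y y' x)
      (fun r x y => by
        rw [← algebraMap_smul K r y, inner_smul_left, Algebra.smul_def]
        simp))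
    1
    (fun x y => by
      simpa [mul_comm] using norm_inner_le_norm (𝕜 := K) y x)

variable (K : Type*) [RCLike K] {T : Type*} [MetricSpace T] [MeasurableSpace T]
  {X : Type*} [NormedAddCommGroup X] [InnerProductSpace K X]

/-- The sesquilinear integral `∫ f dμ ∈ K` of a function `f : T → X` against an `X`-valued measure,
determined by `∫ 1_A x dμ = (x | μ A)`. The real structure on `X` is the restriction of its
`K`-structure. -/
def sesqIntegral (f : T → X) (μ : VectorMeasure T X) : K :=
  letI : NormedSpace ℝ X := NormedSpace.restrictScalars ℝ K X
  haveI : IsScalarTower ℝ K X := IsScalarTower.restrictScalars ℝ K X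
  VectorMeasure.integral μ f (scalarProduct K X)

variable (T X) in
/-- `cabv(X)`: the `σ`-additive measures on the Borel sets of `T` with values in `X` which have
bounded variation, i.e. `|μ|(T) < ∞`. -/
def Cabv : Submodule K (VectorMeasure T X) where
  carrier := {μ | μ.variation univ < ∞}
  zero_mem' := by simp
  add_mem' {μ ν} hμ hν :=
    lt_of_le_of_lt (VectorMeasure.variation_add_le (μ := μ) (ν := ν) univ)
      (by simpa using ENNReal.add_lt_top.2 ⟨hμ, hν⟩)
  smul_mem' c μ hμ := by
    simp only [mem_ofPred_eq, VectorMeasure.variation_smul] at hμ ⊢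
    exact ENNReal.mul_lt_top ENNReal.coe_lt_top hμ

variable (T X) in
/-- The weak* topology on `cabv(X)`: the coarsest topology for which all the maps `μ ↦ ∫ f dμ`,
with `f : T → X` continuous, are continuous. -/
abbrev weakStar : TopologicalSpace (Cabv K T X) :=
  TopologicalSpace.induced (fun μ (f : C(T, X)) => sesqIntegral K f μ) Pi.topologicalSpace

variable (T X) in
/-- `B_a(X)`: the elements of `cabv(X)` with `‖μ‖ = |μ|(T) ≤ a`. -/
def varBall (a : ℝ) : Set (Cabv K T X) :=
  {μ | (μ : VectorMeasure T X).variation univ ≤ ENNReal.ofReal a}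

variable (T) in
/-- `B_a(X, v)`: the elements of `B_a(X)` with `μ(T) = v`. -/
def varBallMass (a : ℝ) (v : X) : Set (Cabv K T X) :=
  {μ ∈ varBall K T X a | (μ : VectorMeasure T X) univ = v}

/-- The Lipschitz constant `‖f‖_L` (equal to `∞` when `f` is not a Lipschitz function). -/
def lipConst (f : C(T, X)) : ℝ≥0∞ :=
  ⨆ (x : T) (y : T) (_ : x ≠ y), edist (f x) (f y) / edist x y

variable (T X) in
/-- `BL₁(X)`: the Lipschitz functions with `‖f‖_BL = ‖f‖_∞ + ‖f‖_L ≤ 1`. -/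
def BLUnit : Set C(T, X) :=
  {f | (⨆ t, ‖f t‖ₑ) + lipConst f ≤ 1}

variable (T X) in
/-- `L₁(X)`: the Lipschitz functions with `‖f‖_L ≤ 1`. -/
def LUnit : Set C(T, X) :=
  {f | lipConst f ≤ 1}

/-- The Monge-Kantorovich norm `‖μ‖_MK`, a supremum taken in `[0, ∞]`. -/
def mkNorm (μ : Cabv K T X) : ℝ≥0∞ :=
  ⨆ f ∈ BLUnit T X, ‖sesqIntegral K f μ‖ₑ

/-- The modified Monge-Kantorovich norm `‖μ‖*_MK`, a supremum taken in `[0, ∞]` (it is used for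
measures with `μ(T) = 0`). -/
def mkNormStar (μ : Cabv K T X) : ℝ≥0∞ :=
  ⨆ f ∈ LUnit T X, ‖sesqIntegral K f μ‖ₑ

/-- The Monge-Kantorovich distance on a set of measures. -/
def dMK (A : Set (Cabv K T X)) (μ ν : A) : ℝ≥0∞ :=
  mkNorm K (μ.1 - ν.1)

/-- The modified Monge-Kantorovich distance on a set of measures. -/
def dMKStar (A : Set (Cabv K T X)) (μ ν : A) : ℝ≥0∞ :=
  mkNormStar K (μ.1 - ν.1)

/-- The weak* topology on a set of measures. -/
abbrev weakStarOn (A : Set (Cabv K T X)) : TopologicalSpace A :=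
  TopologicalSpace.induced Subtype.val (weakStar K T X)

variable (T) in
/-- `B_a⁺(ℝ, v)`: the nonnegative elements of `B_a(ℝ, v)`. -/
def varBallMassPos (a v : ℝ) : Set (Cabv ℝ T ℝ) :=
  {μ ∈ varBallMass ℝ T a v | ∀ s, MeasurableSet s → 0 ≤ (μ : VectorMeasure T ℝ) s}

end

/-- `d` is a metric (in particular, it takes finite values only). -/
def IsMetric {α : Type*} (d : α → α → ℝ≥0∞) : Prop :=
  ∃ m : MetricSpace α, ∀ x y, m.edist x y = d x y

/-- `d` is a metric which makes `α` a compact and complete metric space and whose topology is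
`τ`. -/
def IsCompactMetricFor {α : Type*} (τ : TopologicalSpace α) (d : α → α → ℝ≥0∞) : Prop :=
  ∃ m : MetricSpace α, (∀ x y, m.edist x y = d x y) ∧
    @CompactSpace α m.toUniformSpace.toTopologicalSpace ∧
    @CompleteSpace α m.toUniformSpace ∧
    m.toUniformSpace.toTopologicalSpace = τ

end VectorMK

/-! Everything rests on weak* compactness of the bounded measures of prescribed mass
(`isCompact_varBallMass`). Along an ultrafilter the variations |μ| converge weakly to a finite
measure m, and the integrals ∫ f dμ converge to a linear functional Φ(f). The bound |∫ f dμ| ≤ ∫ ‖f‖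
d|μ| passes to the limit, so |Φ(f)| ≤ ∫ ‖f‖ dm. Such a Φ extends to L¹(m, X), and the Riesz theorem
in X applied to x ↦ Φ(1_s x) yields a limit measure of variation at most m
(`exists_vectorMeasure_of_le_integral_norm`). Testing against constants shows that the mass
survives.

The functions of BL₁(X) separate measures, because indicators of closed sets are limits of Lipschitz
functions. The two distances compare because a measure of mass 0 does not see the constant in f -
f(t₀).

If X is proper, BL₁(X) is totally bounded by Arzelà–Ascoli, so on bounded sets d_MK is controlled by
finitely many integrals. The identity from the weak* to the metric topology is then a continuous
bijection from a compact to a Hausdorff space. Nonnegative measures of mass v are exactly those with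
variation at most v = μ(T), so they form a set already treated. -/

namespace VectorMK

open Filter Topology

set_option linter.unusedSectionVars false

/-! ### Elementary properties of the sesquilinear integral. -/

section Integral

variable {K : Type*} [RCLike K] {T : Type*} [MeasurableSpace T]
  {X : Type*} [NormedAddCommGroup X] [InnerProductSpace K X]

theorem norm_scalarProduct_le [NormedSpace ℝ X] [IsScalarTower ℝ K X] :
    ‖scalarProduct K X‖ ≤ 1 :=
  LinearMap.mkContinuous₂_norm_le _ zero_le_one _

theorem enorm_scalarProduct_le [NormedSpace ℝ X] [IsScalarTower ℝ K X] :
    ‖scalarProduct K X‖ₑ ≤ 1 := by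
  rw [← ofReal_norm]
  exact (ENNReal.ofReal_le_ofReal norm_scalarProduct_le).trans (by simp)

variable {f g : T → X} {μ ν : VectorMeasure T X}

theorem sesqIntegral_congr_ae (h : f =ᵐ[μ.variation] g) :
    sesqIntegral K f μ = sesqIntegral K g μ :=
  let _ : NormedSpace ℝ X := NormedSpace.restrictScalars ℝ K X
  have _ : IsScalarTower ℝ K X := IsScalarTower.restrictScalars ℝ K X
  VectorMeasure.integral_congr_ae h

theorem sesqIntegral_add (hf : Integrable f μ.variation) (hg : Integrable g μ.variation) :
    sesqIntegral K (fun t => f t + g t) μ = sesqIntegral K f μ + sesqIntegral K g μ :=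
  let _ : NormedSpace ℝ X := NormedSpace.restrictScalars ℝ K X
  have _ : IsScalarTower ℝ K X := IsScalarTower.restrictScalars ℝ K X
  VectorMeasure.integral_fun_add hf hg

theorem sesqIntegral_sub (hf : Integrable f μ.variation) (hg : Integrable g μ.variation) :
    sesqIntegral K (fun t => f t - g t) μ = sesqIntegral K f μ - sesqIntegral K g μ :=
  let _ : NormedSpace ℝ X := NormedSpace.restrictScalars ℝ K X
  have _ : IsScalarTower ℝ K X := IsScalarTower.restrictScalars ℝ K X
  VectorMeasure.integral_fun_sub hf hg

theorem sesqIntegral_smul (c : K) (f : T → X) (μ : VectorMeasure T X) :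
    sesqIntegral K (fun t => c • f t) μ = c * sesqIntegral K f μ := by
  let _ : NormedSpace ℝ X := NormedSpace.restrictScalars ℝ K X
  have _ : IsScalarTower ℝ K X := IsScalarTower.restrictScalars ℝ K X
  -- The integral is built over ℝ; homogeneity over K comes from that of (x | μ(s)) in x.
  refine setToFun_smul _ (fun c s x => ?_) c f
  exact inner_smul_right (μ s) x c

theorem sesqIntegral_sub_measure (hμ : Integrable f μ.variation) (hν : Integrable f ν.variation) :
    sesqIntegral K f (μ - ν) = sesqIntegral K f μ - sesqIntegral K f ν :=
  let _ : NormedSpace ℝ X := NormedSpace.restrictScalars ℝ K X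
  have _ : IsScalarTower ℝ K X := IsScalarTower.restrictScalars ℝ K X
  VectorMeasure.integral_sub_vectorMeasure hμ hν

theorem sesqIntegral_const [IsFiniteMeasure μ.variation] (x : X) :
    sesqIntegral K (fun _ => x) μ = inner K (μ univ) x :=
  let _ : NormedSpace ℝ X := NormedSpace.restrictScalars ℝ K X
  have _ : IsScalarTower ℝ K X := IsScalarTower.restrictScalars ℝ K X
  VectorMeasure.integral_const x

theorem sesqIntegral_indicator_const [IsFiniteMeasure μ.variation] {s : Set T}
    (hs : MeasurableSet s) (x : X) :
    sesqIntegral K (s.indicator fun _ => x) μ = inner K (μ s) x := by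
  let _ : NormedSpace ℝ X := NormedSpace.restrictScalars ℝ K X
  have _ : IsScalarTower ℝ K X := IsScalarTower.restrictScalars ℝ K X
  exact setToFun_indicator_const _ hs (measure_ne_top _ _) x

theorem norm_sesqIntegral_le (f : T → X) (μ : VectorMeasure T X) :
    ‖sesqIntegral K f μ‖ ≤ ∫ t, ‖f t‖ ∂μ.variation := by
  let _ : NormedSpace ℝ X := NormedSpace.restrictScalars ℝ K X
  have _ : IsScalarTower ℝ K X := IsScalarTower.restrictScalars ℝ K X
  refine VectorMeasure.norm_integral_le_integral_norm.trans
    (mul_le_of_le_one_left (by positivity) norm_scalarProduct_le)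

theorem enorm_sesqIntegral_le {C : ℝ≥0∞} (h : ∀ t, ‖f t‖ₑ ≤ C) (μ : VectorMeasure T X) :
    ‖sesqIntegral K f μ‖ₑ ≤ C * μ.variation univ := by
  let _ : NormedSpace ℝ X := NormedSpace.restrictScalars ℝ K X
  have _ : IsScalarTower ℝ K X := IsScalarTower.restrictScalars ℝ K X
  refine (VectorMeasure.enorm_integral_le_of_enorm_le_const (ae_of_all _ h)).trans ?_
  gcongr
  exact mul_le_of_le_one_right' enorm_scalarProduct_le

theorem tendsto_sesqIntegral_of_norm_le_const [IsFiniteMeasure μ.variation] {F : ℕ → T → X} {C : ℝ}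
    (hF : ∀ n, AEStronglyMeasurable (F n) μ.variation) (hC : ∀ n t, ‖F n t‖ ≤ C)
    (hlim : ∀ t, Tendsto (fun n => F n t) atTop (𝓝 (f t))) :
    Tendsto (fun n => sesqIntegral K (F n) μ) atTop (𝓝 (sesqIntegral K f μ)) :=
  let _ : NormedSpace ℝ X := NormedSpace.restrictScalars ℝ K X
  have _ : IsScalarTower ℝ K X := IsScalarTower.restrictScalars ℝ K X
  VectorMeasure.tendsto_integral_filter_of_norm_le_const (Eventually.of_forall hF)
    ⟨C, Eventually.of_forall fun n => ae_of_all _ (hC n)⟩ (ae_of_all _ hlim)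

variable [MetricSpace T]

instance (μ : Cabv K T X) : IsFiniteMeasure (μ : VectorMeasure T X).variation := ⟨μ.2⟩

variable [CompactSpace T] [BorelSpace T]

theorem integrable_continuousMap {X : Type*} [NormedAddCommGroup X] (f : C(T, X)) (m : Measure T)
    [IsFiniteMeasure m] : Integrable f m :=
  f.continuous.integrable_of_hasCompactSupport (HasCompactSupport.of_compactSpace f)

end Integral

/-! ### Functionals on L¹(m, X) as vector measures. -/

section Representation

variable {K : Type*} [RCLike K] {T : Type*} [MeasurableSpace T]
  {X : Type*} [NormedAddCommGroup X] [InnerProductSpace K X] [CompleteSpace X]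
  {m : Measure T} [IsFiniteMeasure m]

/-- The functional `x ↦ Ψ (1_s x)` on `X`. -/
noncomputable def indicatorFunctional (Ψ : Lp X 1 m →L[K] K) {s : Set T} (hs : MeasurableSet s) :
    StrongDual K X :=
  LinearMap.mkContinuous
    { toFun x := Ψ (indicatorConstLp 1 hs (measure_ne_top m s) x)
      map_add' x y := by rw [← indicatorConstLp_add, map_add]
      map_smul' c x := by
        rw [RingHom.id_apply, ← map_smul]
        congr 1
        rw [indicatorConstLp, indicatorConstLp, ← MemLp.toLp_const_smul]
        congr 1
        exact Set.indicator_const_smul s c fun _ => x }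
    (‖Ψ‖ * m.real s) fun x => by
      refine (Ψ.le_opNorm _).trans ?_
      rw [mul_assoc, norm_indicatorConstLp one_ne_zero ENNReal.one_ne_top]
      simp [mul_comm]

theorem indicatorFunctional_apply (Ψ : Lp X 1 m →L[K] K) {s : Set T} (hs : MeasurableSet s)
    (x : X) : indicatorFunctional Ψ hs x = Ψ (indicatorConstLp 1 hs (measure_ne_top m s) x) := rfl

theorem norm_indicatorFunctional_le (Ψ : Lp X 1 m →L[K] K) {s : Set T} (hs : MeasurableSet s) :
    ‖indicatorFunctional Ψ hs‖ ≤ ‖Ψ‖ * m.real s :=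
  LinearMap.mkContinuous_norm_le _ (by positivity) _

open Classical in
/-- A functional of norm at most one on `L¹(m, X)` induces an `X`-valued measure. -/
theorem exists_vectorMeasure_of_functional (Ψ : Lp X 1 m →L[K] K) (hΨ : ‖Ψ‖ ≤ 1) :
    ∃ μ : VectorMeasure T X, μ.variation ≤ m ∧ ∀ (s : Set T) (hs : MeasurableSet s) (x : X),
      inner K (μ s) x = Ψ (indicatorConstLp 1 hs (measure_ne_top m s) x) := by
  -- A vector measure must vanish on non-measurable sets, hence the default 0.
  let r (s : Set T) : X := if hs : MeasurableSet s then
    (InnerProductSpace.toDual K X).symm (indicatorFunctional Ψ hs) else 0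
  have hr (s : Set T) (hs : MeasurableSet s) (x : X) :
      inner K (r s) x = Ψ (indicatorConstLp 1 hs (measure_ne_top m s) x) := by
    simp only [r, dif_pos hs, InnerProductSpace.toDual_symm_apply, indicatorFunctional_apply]
  have hle (s : Set T) : ‖r s‖ₑ ≤ m s := by
    by_cases hs : MeasurableSet s
    · rw [← ofReal_norm, ← ofReal_measureReal (measure_ne_top m s)]
      simp only [r, dif_pos hs, LinearIsometryEquiv.norm_map]
      gcongr
      exact (norm_indicatorFunctional_le Ψ hs).trans
        (mul_le_of_le_one_left measureReal_nonneg hΨ)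
    · simp [r, hs]
  refine ⟨VectorMeasure.of_additive_of_le_measure r hle ?_ fun s hs => dif_neg hs,
    VectorMeasure.variation_le_of_forall_enorm_le fun s _ => hle s, hr⟩
  intro s t hs ht hst
  refine ext_inner_right K fun x => ?_
  rw [inner_add_left, hr _ hs, hr _ ht, hr _ (hs.union ht), ← map_add,
    indicatorConstLp_disjoint_union hs ht _ _ hst]

/-- Both sides are additive and continuous on L¹(m, X), the left one being 1-Lipschitz since |μ| ≤
m, and they agree on indicators, whose sums are dense. -/
theorem sesqIntegral_eq_functional {μ : VectorMeasure T X} (hμ : μ.variation ≤ m)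
    (Ψ : Lp X 1 m →L[K] K) (h : ∀ (s : Set T) (hs : MeasurableSet s) (x : X),
      inner K (μ s) x = Ψ (indicatorConstLp 1 hs (measure_ne_top m s) x)) (g : Lp X 1 m) :
    sesqIntegral K g μ = Ψ g := by
  have hfin : IsFiniteMeasure μ.variation := isFiniteMeasure_of_le m hμ
  have hac : μ.variation ≪ m := Measure.absolutelyContinuous_of_le hμ
  have hint (g : Lp X 1 m) : Integrable g μ.variation :=
    (L1.integrable_coeFn g).mono_measure hμ
  induction g using Lp.induction ENNReal.one_ne_top with
  | indicatorConst c hs hμs =>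
    rw [Lp.simpleFunc.coe_indicatorConst, ← h, ← sesqIntegral_indicator_const hs]
    exact sesqIntegral_congr_ae (hac.ae_le indicatorConstLp_coeFn)
  | add hf hg _ ihf ihg =>
    rw [map_add, ← ihf, ← ihg, ← sesqIntegral_add (hint _) (hint _)]
    exact sesqIntegral_congr_ae (hac.ae_le (Lp.coeFn_add _ _))
  | isClosed =>
    refine isClosed_eq ?_ Ψ.continuous
    refine LipschitzWith.continuous (K := 1) (LipschitzWith.of_dist_le_mul fun f g => ?_)
    rw [dist_eq_norm, ← sesqIntegral_sub (hint _) (hint _), NNReal.coe_one, one_mul, dist_eq_norm,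
      L1.norm_eq_integral_norm, integral_congr_ae ((Lp.coeFn_sub f g).mono fun t ht => by
        rw [ht])]
    refine (norm_sesqIntegral_le _ _).trans (integral_mono_measure hμ
      (ae_of_all _ fun _ => norm_nonneg _) ?_)
    exact ((L1.integrable_coeFn f).sub (L1.integrable_coeFn g)).norm

end Representation

/-! ### Representation of dominated functionals on C(T, X). -/

section RieszSinger

variable {K : Type*} [RCLike K] {T : Type*} [MetricSpace T] [CompactSpace T] [MeasurableSpace T]
  [BorelSpace T] {X : Type*} [NormedAddCommGroup X] [InnerProductSpace K X] [CompleteSpace X]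

/-- A linear functional on `C(T, X)` dominated by the finite measure `m` is represented by
an `X`-valued measure whose variation is at most `m`. -/
theorem exists_vectorMeasure_of_le_integral_norm (Φ : C(T, X) →ₗ[K] K) (m : Measure T)
    [IsFiniteMeasure m] (hΦ : ∀ f, ‖Φ f‖ ≤ ∫ t, ‖f t‖ ∂m) :
    ∃ μ : VectorMeasure T X, μ.variation ≤ m ∧ ∀ f : C(T, X), sesqIntegral K f μ = Φ f := by
  let _ : NormedSpace ℝ X := NormedSpace.restrictScalars ℝ K X
  have _ : IsScalarTower ℝ K X := IsScalarTower.restrictScalars ℝ K X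
  -- C(T, X) is dense in L¹(m, X), so domination by m extends the functional with norm at most 1.
  let e : C(T, X) →ₗ[K] Lp X 1 m := (ContinuousMap.toLp 1 m K).toLinearMap
  have he : DenseRange e := ContinuousMap.toLp_denseRange X m K ENNReal.one_ne_top
  have hbound (f : C(T, X)) : ‖Φ f‖ ≤ 1 * ‖e f‖ := by
    rw [one_mul, L1.norm_eq_integral_norm]
    refine (hΦ f).trans_eq (integral_congr_ae ?_)
    filter_upwards [ContinuousMap.coeFn_toLp m (𝕜 := K) (p := 1) f] with t ht
    exact congrArg norm ht.symm
  let Ψ := Φ.extendOfNorm e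
  obtain ⟨μ, hμ, h⟩ := exists_vectorMeasure_of_functional Ψ
    (Ψ.opNorm_le_bound zero_le_one (LinearMap.norm_extendOfNorm_apply_le he 1 hbound))
  refine ⟨μ, hμ, fun f => ?_⟩
  rw [← LinearMap.extendOfNorm_eq he ⟨1, hbound⟩ f, ← sesqIntegral_eq_functional hμ Ψ h]
  exact sesqIntegral_congr_ae ((Measure.absolutelyContinuous_of_le hμ).ae_le
    (ContinuousMap.coeFn_toLp m (𝕜 := K) (p := 1) f).symm)

end RieszSinger

/-! ### Lipschitz functions separate measures. -/

section Lipschitz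

variable {K : Type*} [RCLike K] {T : Type*} [MetricSpace T] [CompactSpace T] [MeasurableSpace T]
  [BorelSpace T] {X : Type*} [NormedAddCommGroup X] [InnerProductSpace K X]

theorem lipConst_le_iff {X : Type*} [NormedAddCommGroup X] {f : C(T, X)} {C : ℝ≥0∞} :
    lipConst f ≤ C ↔ ∀ x y, edist (f x) (f y) ≤ C * edist x y := by
  simp only [lipConst, iSup_le_iff]
  refine forall₂_congr fun x y => ⟨fun h => ?_, fun h hxy => ?_⟩
  · rcases eq_or_ne x y with rfl | hxy
    · simp
    · exact (ENNReal.div_le_iff (edist_pos.2 hxy).ne' (edist_ne_top x y)).1 (h hxy)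
  · exact (ENNReal.div_le_iff (edist_pos.2 hxy).ne' (edist_ne_top x y)).2 h

theorem BLUnit_subset_LUnit {X : Type*} [NormedAddCommGroup X] : BLUnit T X ⊆ LUnit T X :=
  fun f hf => show lipConst f ≤ 1 from le_trans le_add_self hf

theorem enorm_le_one_of_mem_BLUnit {X : Type*} [NormedAddCommGroup X] {f : C(T, X)}
    (hf : f ∈ BLUnit T X) (t : T) : ‖f t‖ₑ ≤ 1 :=
  (le_iSup (fun t => ‖f t‖ₑ) t).trans (le_self_add.trans hf)

theorem smul_mem_BLUnit {f : C(T, X)} {A B : ℝ≥0∞} (hA : ∀ t, ‖f t‖ₑ ≤ A)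
    (hB : ∀ x y, edist (f x) (f y) ≤ B * edist x y) {c : K} (hc : ‖c‖ₑ * (A + B) ≤ 1) :
    c • f ∈ BLUnit T X := by
  refine le_trans ?_ hc
  rw [mul_add]
  refine add_le_add (iSup_le fun t => ?_) (lipConst_le_iff.2 fun x y => ?_)
  · rw [ContinuousMap.smul_apply, enorm_smul]
    gcongr
    exact hA t
  · rw [ContinuousMap.smul_apply, ContinuousMap.smul_apply, edist_eq_enorm_sub, ← smul_sub,
      enorm_smul, ← edist_eq_enorm_sub, mul_assoc]
    gcongr
    exact hB x y

/-- The integrals of a measure against all the functions of `BL₁(X)` determine the integrals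
against all the Lipschitz functions. -/
theorem sesqIntegral_eq_zero_of_lipschitz {μ : VectorMeasure T X}
    (h : ∀ f ∈ BLUnit T X, sesqIntegral K f μ = 0) {f : C(T, X)} {C : NNReal}
    (hf : LipschitzWith C f) : sesqIntegral K f μ = 0 := by
  -- Scales f into BL₁(X); the summand 1 keeps the denominator positive.
  let r : ℝ := (‖f‖ + C + 1)⁻¹
  have hr : 0 < r := by positivity
  have key := h ((r : K) • f) (smul_mem_BLUnit (A := ENNReal.ofReal ‖f‖) (B := C) (fun t => by
      rw [← ofReal_norm]
      exact ENNReal.ofReal_le_ofReal (f.norm_coe_le_norm t)) hf (by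
      rw [← ofReal_norm, RCLike.norm_ofReal, abs_of_pos hr, ← ENNReal.ofReal_coe_nnreal,
        ← ENNReal.ofReal_add (by positivity) (by positivity), ← ENNReal.ofReal_mul hr.le,
        ENNReal.ofReal_le_one]
      refine inv_mul_le_one_of_le₀ (by linarith) (by positivity)))
  have hs := sesqIntegral_smul (r : K) f μ
  refine (mul_eq_zero.1 (hs.symm.trans key)).resolve_left ?_
  exact_mod_cast hr.ne'

/-- Thickened indicators of a closed set are Lipschitz and tend boundedly and pointwise to its
indicator, so μ vanishes on closed sets, a π-system generating the Borel sets. -/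
theorem eq_zero_of_forall_sesqIntegral_eq_zero {μ : VectorMeasure T X}
    [IsFiniteMeasure μ.variation] (h : ∀ f ∈ BLUnit T X, sesqIntegral K f μ = 0) : μ = 0 := by
  have hclosed (F : Set T) (hF : IsClosed F) : μ F = 0 := by
    refine ext_inner_right K fun x => ?_
    rw [inner_zero_left, ← sesqIntegral_indicator_const hF.measurableSet]
    let δ (n : ℕ) : ℝ := 1 / ((n : ℝ) + 1)
    have hδ (n : ℕ) : 0 < δ n := Nat.one_div_pos_of_nat
    let u (n : ℕ) : C(T, X) := ⟨fun t => (((thickenedIndicator (hδ n) F t : NNReal) : ℝ) : K) • x,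
      by fun_prop⟩
    have hu (n : ℕ) : LipschitzWith ((δ n).toNNReal⁻¹ * ‖x‖₊) (u n) := by
      refine LipschitzWith.of_dist_le_mul fun s t => ?_
      have := (lipschitzWith_thickenedIndicator (hδ n) F).dist_le_mul s t
      rw [NNReal.dist_eq] at this
      rw [dist_eq_norm]
      change ‖(((thickenedIndicator (hδ n) F s : NNReal) : ℝ) : K) • x
        - (((thickenedIndicator (hδ n) F t : NNReal) : ℝ) : K) • x‖ ≤ _
      rw [← sub_smul, norm_smul, ← RCLike.ofReal_sub, RCLike.norm_ofReal, NNReal.coe_mul,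
        coe_nnnorm, mul_right_comm]
      gcongr
    have hzero (n : ℕ) : sesqIntegral K (u n) μ = 0 := sesqIntegral_eq_zero_of_lipschitz h (hu n)
    refine tendsto_nhds_unique (tendsto_sesqIntegral_of_norm_le_const (F := fun n => u n)
      (C := ‖x‖) (fun n => (integrable_continuousMap (u n) _).1) (fun n t => ?_) fun t => ?_)
      (by simp only [hzero, tendsto_const_nhds])
    · change ‖(((thickenedIndicator (hδ n) F t : NNReal) : ℝ) : K) • x‖ ≤ ‖x‖
      rw [norm_smul, RCLike.norm_ofReal, abs_of_nonneg (NNReal.coe_nonneg _)]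
      refine mul_le_of_le_one_left (norm_nonneg x) ?_
      exact_mod_cast thickenedIndicator_le_one (hδ n) F t
    · have ht := (tendsto_pi_nhds.1 (thickenedIndicator_tendsto_indicator_closure hδ
        tendsto_one_div_add_atTop_nhds_zero_nat F)) t
      have hc : Continuous fun r : NNReal => ((r : ℝ) : K) • x := by fun_prop
      have := (hc.tendsto _).comp ht
      rw [hF.closure_eq] at this
      have hind : F.indicator (fun _ => x) t =
          (((F.indicator (fun _ => (1 : NNReal)) t : NNReal) : ℝ) : K) • x := by
        by_cases htF : t ∈ F <;> simp [htF]
      rw [hind]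
      exact this
  refine VectorMeasure.ext_of_generateFrom {s | IsClosed s} (fun s hs => ?_)
    (BorelSpace.measurable_eq.trans (borel_eq_generateFrom_isClosed (α := T))) isPiSystem_isClosed ?_
  · simpa using hclosed s hs
  · simpa using hclosed univ isClosed_univ

end Lipschitz

/-! ### The weak* topology and compactness. -/

section WeakStar

variable {K : Type*} [RCLike K] {T : Type*} [MetricSpace T] [CompactSpace T] [MeasurableSpace T]
  [BorelSpace T] {X : Type*} [NormedAddCommGroup X] [InnerProductSpace K X]

theorem Cabv.ext_sesqIntegral {μ ν : Cabv K T X}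
    (h : ∀ f ∈ BLUnit T X, sesqIntegral K f μ = sesqIntegral K f ν) : μ = ν := by
  refine sub_eq_zero.1 (Subtype.ext ?_)
  refine eq_zero_of_forall_sesqIntegral_eq_zero (K := K)
    (μ := ((μ - ν : Cabv K T X) : VectorMeasure T X)) fun f hf => ?_
  rw [Submodule.coe_sub, sesqIntegral_sub_measure (integrable_continuousMap f _)
    (integrable_continuousMap f _), h f hf, sub_self]

theorem tendsto_weakStar_iff {ι : Type*} {l : Filter ι} {u : ι → Cabv K T X} {μ : Cabv K T X} :
    Tendsto u l (@nhds _ (weakStar K T X) μ) ↔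
      ∀ f : C(T, X), Tendsto (fun i => sesqIntegral K f (u i)) l (𝓝 (sesqIntegral K f μ)) := by
  rw [nhds_induced, tendsto_comap_iff, tendsto_pi_nhds]
  rfl

theorem t2Space_weakStar : @T2Space _ (weakStar K T X) := by
  let _ := weakStar K T X
  refine T2Space.of_injective_continuous (f := fun (μ : Cabv K T X) (f : C(T, X)) =>
    sesqIntegral K f μ) (fun μ ν h => ?_) continuous_induced_dom
  exact Cabv.ext_sesqIntegral fun f _ => congrFun h f

theorem variation_univ_toReal_le {a : ℝ} (ha : 0 ≤ a) {μ : Cabv K T X}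
    (hμ : μ ∈ varBall K T X a) : (μ : VectorMeasure T X).variation.real univ ≤ a :=
  ENNReal.toReal_le_of_le_ofReal ha hμ

theorem norm_sesqIntegral_le_of_mem_varBall {a : ℝ} (ha : 0 ≤ a) {μ : Cabv K T X}
    (hμ : μ ∈ varBall K T X a) (f : C(T, X)) : ‖sesqIntegral K f μ‖ ≤ ‖f‖ * a := by
  refine (norm_sesqIntegral_le f _).trans ?_
  calc ∫ t, ‖f t‖ ∂(μ : VectorMeasure T X).variation
      ≤ ∫ _, ‖f‖ ∂(μ : VectorMeasure T X).variation :=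
        integral_mono (integrable_continuousMap f _).norm (integrable_const _) f.norm_coe_le_norm
    _ = (μ : VectorMeasure T X).variation.real univ * ‖f‖ := by simp
    _ ≤ ‖f‖ * a := by
        rw [mul_comm]
        gcongr
        exact variation_univ_toReal_le ha hμ

/-- The variation of a measure, as a bundled finite measure. -/
noncomputable def finiteVariation (μ : Cabv K T X) : FiniteMeasure T :=
  ⟨(μ : VectorMeasure T X).variation, inferInstance⟩

variable [CompleteSpace X]

theorem isCompact_varBallMass {a : ℝ} (ha : 0 ≤ a) (v : X) :
    @IsCompact (Cabv K T X) (weakStar K T X) (varBallMass K T a v) := by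
  let _ := weakStar K T X
  refine isCompact_iff_ultrafilter_le_nhds'.2 fun F hF => ?_
  have hball : ∀ᶠ μ in (F : Filter (Cabv K T X)), μ ∈ varBall K T X a :=
    mem_of_superset hF fun μ hμ => hμ.1
  -- Scalar compactness of the finite measures of mass at most a gives a limit m of the variations.
  obtain ⟨m, hma, hm⟩ := (isCompact_setOfPred_finiteMeasure_le_of_compactSpace T
    a.toNNReal).ultrafilter_le_nhds' (F.map finiteVariation) (Ultrafilter.mem_map.2 <| by
      filter_upwards [hball] with μ hμ
      have h : (μ : VectorMeasure T X).variation univ ≤ ENNReal.ofReal a := hμ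
      exact ENNReal.toNNReal_mono ENNReal.ofReal_ne_top h)
  have hlim (f : C(T, X)) : ∃ z, Tendsto (fun μ : Cabv K T X => sesqIntegral K f μ) F (𝓝 z) := by
    obtain ⟨z, -, hz⟩ := (isCompact_closedBall (0 : K) (‖f‖ * a)).ultrafilter_le_nhds'
      (F.map fun μ : Cabv K T X => sesqIntegral K f μ) (Ultrafilter.mem_map.2 <| by
        filter_upwards [hball] with μ hμ
        simpa using norm_sesqIntegral_le_of_mem_varBall ha hμ f)
    exact ⟨z, hz⟩
  choose Φ hΦ using hlim
  have hint (f : C(T, X)) (μ : Cabv K T X) : Integrable f (μ : VectorMeasure T X).variation :=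
    integrable_continuousMap f _
  let Φl : C(T, X) →ₗ[K] K :=
    { toFun := Φ
      map_add' f g := by
        refine tendsto_nhds_unique (hΦ (f + g)) (((hΦ f).add (hΦ g)).congr fun μ => ?_)
        exact (sesqIntegral_add (hint f μ) (hint g μ)).symm
      map_smul' c f := by
        refine tendsto_nhds_unique (hΦ (c • f)) (((hΦ f).const_mul c).congr fun μ => ?_)
        exact (sesqIntegral_smul c f _).symm }
  -- The cruder bound a‖f‖ would not do: domination by a measure is what makes the limit functional
  -- σ-additive.
  have hbound (f : C(T, X)) : ‖Φl f‖ ≤ ∫ t, ‖f t‖ ∂(m : Measure T) := by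
    have h := (FiniteMeasure.tendsto_iff_forall_integral_tendsto.1 hm)
      (BoundedContinuousFunction.mkOfCompact ⟨fun t => ‖f t‖, by fun_prop⟩)
    exact le_of_tendsto_of_tendsto (hΦ f).norm h
      (Eventually.of_forall fun μ => norm_sesqIntegral_le f _)
  obtain ⟨μ, hμm, hμ⟩ := exists_vectorMeasure_of_le_integral_norm Φl (m : Measure T) hbound
  have hμa : μ.variation univ ≤ ENNReal.ofReal a := by
    refine (hμm univ).trans ?_
    rw [← FiniteMeasure.ennreal_mass]
    exact ENNReal.coe_le_coe.2 hma
  have hfin : IsFiniteMeasure μ.variation := ⟨hμa.trans_lt ENNReal.ofReal_lt_top⟩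
  let ν : Cabv K T X := ⟨μ, hμa.trans_lt ENNReal.ofReal_lt_top⟩
  have hνlim : (F : Filter (Cabv K T X)) ≤ 𝓝 ν :=
    tendsto_weakStar_iff.2 fun f => (hΦ f).trans_eq (congrArg 𝓝 (hμ f).symm)
  refine ⟨ν, ⟨hμa, ext_inner_right K fun x => ?_⟩, hνlim⟩
  -- Integrals of the constants x determine the mass and pass to the weak* limit.
  refine (sesqIntegral_const (μ := μ) x).symm.trans ?_
  refine tendsto_nhds_unique (tendsto_weakStar_iff.1 (tendsto_id'.2 hνlim)
    (ContinuousMap.const T x)) (tendsto_const_nhds.congr' ?_)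
  filter_upwards [hF] with μ hμ
  rw [← hμ.2]
  exact (sesqIntegral_const x).symm

theorem isClosed_varBallMass {a : ℝ} (ha : 0 ≤ a) (v : X) :
    @IsClosed (Cabv K T X) (weakStar K T X) (varBallMass K T a v) :=
  @IsCompact.isClosed _ (weakStar K T X) t2Space_weakStar _ (isCompact_varBallMass ha v)

theorem varBallMass_nonempty [Nonempty T] {a : ℝ} {v : X} (hv : ‖v‖ ≤ a) :
    (varBallMass K T a v).Nonempty := by
  obtain ⟨t⟩ := ‹Nonempty T›
  have h : (VectorMeasure.dirac t v).variation univ = ‖v‖ₑ := by simp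
  refine ⟨⟨VectorMeasure.dirac t v, h.trans_lt enorm_lt_top⟩, h.trans_le ?_, ?_⟩
  · rw [← ofReal_norm]
    exact ENNReal.ofReal_le_ofReal hv
  · simp

end WeakStar

/-! ### The two Monge-Kantorovich distances. -/

section Metric

variable {K : Type*} [RCLike K] {T : Type*} [MetricSpace T] [CompactSpace T] [MeasurableSpace T]
  [BorelSpace T] {X : Type*} [NormedAddCommGroup X] [InnerProductSpace K X]

theorem isMetric_of_edist {α : Type*} {d : α → α → ℝ≥0∞} (h0 : ∀ x, d x x = 0)
    (hsymm : ∀ x y, d x y = d y x) (htri : ∀ x y z, d x z ≤ d x y + d y z)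
    (hfin : ∀ x y, d x y ≠ ∞) (hsep : ∀ x y, d x y = 0 → x = y) : IsMetric d := by
  let e : EMetricSpace α :=
    { edist := d
      edist_self := h0
      edist_comm := hsymm
      edist_triangle := htri
      eq_of_edist_eq_zero := hsep _ _ }
  exact ⟨EMetricSpace.toMetricSpace hfin, fun _ _ => rfl⟩

theorem sesqIntegral_coe_sub (f : C(T, X)) (μ ν : Cabv K T X) :
    sesqIntegral K f ((μ - ν : Cabv K T X) : VectorMeasure T X) =
      sesqIntegral K f μ - sesqIntegral K f ν := by
  rw [Submodule.coe_sub]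
  exact sesqIntegral_sub_measure (integrable_continuousMap f _) (integrable_continuousMap f _)

section SupremumDistance

variable {S : Set C(T, X)}

/-- The pseudometric axioms are proved for an arbitrary test set `S`, so that they serve both
`BLUnit` and `LUnit`. -/
theorem supNorm_sub_self (μ : Cabv K T X) :
    ⨆ f ∈ S, ‖sesqIntegral K f ((μ - μ : Cabv K T X) : VectorMeasure T X)‖ₑ = 0 := by
  refine nonpos_iff_eq_zero.1 (iSup₂_le fun f _ => ?_)
  rw [sesqIntegral_coe_sub, sub_self, enorm_zero]

theorem supNorm_sub_comm (μ ν : Cabv K T X) :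
    ⨆ f ∈ S, ‖sesqIntegral K f ((μ - ν : Cabv K T X) : VectorMeasure T X)‖ₑ =
      ⨆ f ∈ S, ‖sesqIntegral K f ((ν - μ : Cabv K T X) : VectorMeasure T X)‖ₑ := by
  simp only [sesqIntegral_coe_sub, enorm_sub_rev]

theorem supNorm_sub_triangle (μ ν ρ : Cabv K T X) :
    ⨆ f ∈ S, ‖sesqIntegral K f ((μ - ρ : Cabv K T X) : VectorMeasure T X)‖ₑ ≤
      (⨆ f ∈ S, ‖sesqIntegral K f ((μ - ν : Cabv K T X) : VectorMeasure T X)‖ₑ) +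
        ⨆ f ∈ S, ‖sesqIntegral K f ((ν - ρ : Cabv K T X) : VectorMeasure T X)‖ₑ := by
  refine iSup₂_le fun f hf => ?_
  calc ‖sesqIntegral K f ((μ - ρ : Cabv K T X) : VectorMeasure T X)‖ₑ
      ≤ ‖sesqIntegral K f ((μ - ν : Cabv K T X) : VectorMeasure T X)‖ₑ +
          ‖sesqIntegral K f ((ν - ρ : Cabv K T X) : VectorMeasure T X)‖ₑ := by
        rw [sesqIntegral_coe_sub, sesqIntegral_coe_sub, sesqIntegral_coe_sub,
          ← sub_add_sub_cancel _ (sesqIntegral K f ν)]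
        exact enorm_add_le _ _
    _ ≤ _ := add_le_add
        (le_iSup₂ (f := fun f (_ : f ∈ S) =>
          ‖sesqIntegral K f ((μ - ν : Cabv K T X) : VectorMeasure T X)‖ₑ) f hf)
        (le_iSup₂ (f := fun f (_ : f ∈ S) =>
          ‖sesqIntegral K f ((ν - ρ : Cabv K T X) : VectorMeasure T X)‖ₑ) f hf)

end SupremumDistance

theorem enorm_sesqIntegral_le_mkNorm (μ : Cabv K T X) {f : C(T, X)} (hf : f ∈ BLUnit T X) :
    ‖sesqIntegral K f μ‖ₑ ≤ mkNorm K μ :=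
  le_iSup₂ (f := fun f (_ : f ∈ BLUnit T X) => ‖sesqIntegral K f μ‖ₑ) f hf

theorem mkNorm_le_variation (μ : Cabv K T X) :
    mkNorm K μ ≤ (μ : VectorMeasure T X).variation univ :=
  iSup₂_le fun f hf => by
    simpa using enorm_sesqIntegral_le (enorm_le_one_of_mem_BLUnit hf) (μ : VectorMeasure T X)

theorem mkNorm_ne_top (μ : Cabv K T X) : mkNorm K μ ≠ ∞ :=
  ((mkNorm_le_variation μ).trans_lt μ.2).ne

theorem mkNorm_le_mkNormStar (μ : Cabv K T X) : mkNorm K μ ≤ mkNormStar K μ :=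
  biSup_mono BLUnit_subset_LUnit

theorem eq_of_mkNorm_sub_eq_zero {μ ν : Cabv K T X} (h : mkNorm K (μ - ν) = 0) : μ = ν := by
  refine Cabv.ext_sesqIntegral fun f hf => sub_eq_zero.1 ?_
  rw [← sesqIntegral_coe_sub, ← enorm_eq_zero, ← nonpos_iff_eq_zero, ← h]
  exact enorm_sesqIntegral_le_mkNorm _ hf

theorem ediam_univ_ne_top : Metric.ediam (univ : Set T) ≠ ∞ :=
  isCompact_univ.isBounded.ediam_ne_top

theorem mkNormStar_le_mkNorm_mul [Nonempty T] {μ : Cabv K T X}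
    (hμ : (μ : VectorMeasure T X) univ = 0) :
    mkNormStar K μ ≤ mkNorm K μ * (Metric.ediam (univ : Set T) + 1) := by
  obtain ⟨t₀⟩ := ‹Nonempty T›
  -- For f in L₁(X), f - f(t₀) has sup norm at most diam(T) and Lipschitz constant at most 1, so
  -- dividing by `D` lands in BL₁(X).
  set D := Metric.ediam (univ : Set T) + 1 with hD
  have hDtop : D ≠ ∞ := by simp [hD, ediam_univ_ne_top]
  have hD0 : D ≠ 0 := by simp [hD]
  have hDpos : 0 < D.toReal := ENNReal.toReal_pos hD0 hDtop
  refine iSup₂_le fun f hf => ?_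
  have hlip := lipConst_le_iff.1 (show lipConst f ≤ 1 from hf)
  let c : K := (D.toReal⁻¹ : ℝ)
  have hc : c ≠ 0 := by simpa [c] using hDpos.ne'
  have hcnorm : ‖c‖ₑ = D⁻¹ := by
    rw [← ofReal_norm, RCLike.norm_ofReal, abs_of_pos (by positivity), ENNReal.ofReal_inv_of_pos
      hDpos, ENNReal.ofReal_toReal hDtop]
  let g : C(T, X) := f - ContinuousMap.const T (f t₀)
  have hg : c • g ∈ BLUnit T X := by
    refine smul_mem_BLUnit (A := Metric.ediam (univ : Set T)) (B := 1) (fun t => ?_)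
      (fun x y => ?_) ?_
    · change ‖f t - f t₀‖ₑ ≤ _
      rw [← edist_eq_enorm_sub]
      refine (hlip t t₀).trans ?_
      rw [one_mul]
      exact Metric.edist_le_ediam_of_mem (mem_univ _) (mem_univ _)
    · change edist (f x - f t₀) (f y - f t₀) ≤ _
      rw [edist_sub_right]
      exact hlip x y
    · rw [hcnorm, ← hD, ENNReal.inv_mul_cancel hD0 hDtop]
  -- Zero mass makes the subtracted constant invisible.
  have hgint : sesqIntegral K g (μ : VectorMeasure T X) = sesqIntegral K f μ := by
    have := sesqIntegral_sub (K := K) (integrable_continuousMap f (μ : VectorMeasure T X).variation)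
      (integrable_const (f t₀))
    rw [sesqIntegral_const, hμ, inner_zero_left, sub_zero] at this
    exact this
  have hcg : sesqIntegral K (c • g : C(T, X)) (μ : VectorMeasure T X) =
      c * sesqIntegral K f μ := by
    rw [← hgint]
    exact sesqIntegral_smul c g _
  have := enorm_sesqIntegral_le_mkNorm μ hg
  rw [hcg, enorm_mul, hcnorm, mul_comm, ← div_eq_mul_inv] at this
  exact (ENNReal.div_le_iff hD0 hDtop).1 this

theorem isMetric_dMK (A : Set (Cabv K T X)) : IsMetric (dMK K A) :=
  isMetric_of_edist (fun μ => supNorm_sub_self μ.1) (fun μ ν => supNorm_sub_comm μ.1 ν.1)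
    (fun μ ν ρ => supNorm_sub_triangle μ.1 ν.1 ρ.1) (fun _ _ => mkNorm_ne_top _)
    fun _ _ h => Subtype.ext (eq_of_mkNorm_sub_eq_zero h)

theorem dMK_le_dMKStar (A : Set (Cabv K T X)) (μ ν : A) : dMK K A μ ν ≤ dMKStar K A μ ν :=
  mkNorm_le_mkNormStar _

theorem dMKStar_le_dMK_mul [Nonempty T] {a : ℝ} {v : X} (μ ν : varBallMass K T a v) :
    dMKStar K _ μ ν ≤ dMK K _ μ ν * (Metric.ediam (univ : Set T) + 1) := by
  refine mkNormStar_le_mkNorm_mul ?_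
  rw [Submodule.coe_sub, sub_apply, μ.2.2, ν.2.2, sub_self]

theorem isMetric_dMKStar [Nonempty T] (a : ℝ) (v : X) :
    IsMetric (dMKStar K (varBallMass K T a v)) :=
  isMetric_of_edist (fun μ => supNorm_sub_self μ.1) (fun μ ν => supNorm_sub_comm μ.1 ν.1)
    (fun μ ν ρ => supNorm_sub_triangle μ.1 ν.1 ρ.1)
    (fun μ ν => ((dMKStar_le_dMK_mul μ ν).trans_lt (ENNReal.mul_lt_top (mkNorm_ne_top _).lt_top
      (by simp [ediam_univ_ne_top.lt_top]))).ne)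
    fun μ ν h => Subtype.ext (eq_of_mkNorm_sub_eq_zero
      (nonpos_iff_eq_zero.1 ((dMK_le_dMKStar _ μ ν).trans h.le)))

end Metric

theorem eq_induced_of_continuous_injective {α β : Type*} [τ : TopologicalSpace α]
    [σ : TopologicalSpace β] [CompactSpace α] [T2Space β] {f : α → β} (hf : Continuous f)
    (hinj : Function.Injective f) : τ = σ.induced f :=
  (hf.isClosedEmbedding hinj).isInducing.eq_induced

/-! ### Metrizing the weak* topology when X is proper. -/

section FiniteDimensional

variable {K : Type*} [RCLike K] {T : Type*} [MetricSpace T] [CompactSpace T] [MeasurableSpace T]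
  [BorelSpace T] {X : Type*} [NormedAddCommGroup X] [InnerProductSpace K X]

/-- Arzelà–Ascoli: the family is 1-Lipschitz with values in the closed unit ball, which is compact
because `X` is proper. -/
theorem totallyBounded_BLUnit {X : Type*} [NormedAddCommGroup X] [ProperSpace X] :
    TotallyBounded (BLUnit T X) := by
  let e := ContinuousMap.isometryEquivBoundedOfCompact T X
  have hcpt : IsCompact (closure (e '' BLUnit T X)) := by
    refine BoundedContinuousFunction.arzela_ascoli (Metric.closedBall 0 1)
      (isCompact_closedBall 0 1) _ ?_ ?_
    · rintro _ t ⟨f, hf, rfl⟩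
      rw [mem_closedBall_zero_iff]
      have := enorm_le_one_of_mem_BLUnit hf t
      rwa [← ofReal_norm, ENNReal.ofReal_le_one] at this
    · refine (LipschitzWith.uniformEquicontinuous (fun g : e '' BLUnit T X => (g.1 : T → X)) 1
        ?_).equicontinuous
      rintro ⟨_, f, hf, rfl⟩ x y
      exact lipConst_le_iff.1 (show lipConst f ≤ 1 from BLUnit_subset_LUnit hf) x y
  exact (totallyBounded_image_iff e.isometry.isUniformInducing).1
    (hcpt.totallyBounded.subset subset_closure)

/-- A finite net of BL₁(X) reduces the supremum to finitely many weak* conditions; the variation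
bound controls the error uniformly. -/
theorem eventually_mkNorm_sub_lt [ProperSpace X] {a : ℝ} (ha : 0 ≤ a) {A : Set (Cabv K T X)}
    (hA : A ⊆ varBall K T X a) (μ : A) {ε : ℝ≥0∞} (hε : 0 < ε) :
    ∀ᶠ ν in @nhds A (weakStarOn K A) μ, dMK K A ν μ ≤ ε := by
  obtain ⟨r, hr0, hrε⟩ := ENNReal.lt_iff_exists_nnreal_btwn.1 hε
  have hr : (0 : ℝ) < r := by exact_mod_cast hr0
  -- Replacing f by a net point costs at most δa ≤ r/4 for each of the two measures, leaving r/2 for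
  -- the net point itself; a + 1 allows a = 0.
  let δ : ℝ := r / (4 * (a + 1))
  have hδ : 0 < δ := by positivity
  obtain ⟨s, hs, hcover⟩ := Metric.totallyBounded_iff.1 (totallyBounded_BLUnit (T := T) (X := X))
    δ hδ
  have hev : ∀ᶠ ν in @nhds A (weakStarOn K A) μ, ∀ g ∈ s,
      ‖sesqIntegral K g ν.1 - sesqIntegral K g μ.1‖ < r / 2 := by
    refine (Filter.eventually_all_finite hs).2 fun g _ => ?_
    have h : Tendsto (fun ν : A => ν.1) (@nhds A (weakStarOn K A) μ)
        (@nhds _ (weakStar K T X) μ.1) := by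
      rw [@nhds_induced]
      exact tendsto_comap
    have := tendsto_iff_norm_sub_tendsto_zero.1 (tendsto_weakStar_iff.1 h g)
    exact this.eventually_lt_const (half_pos hr)
  filter_upwards [hev] with ν hν
  refine le_trans (iSup₂_le fun f hf => ?_) hrε.le
  obtain ⟨g, hg, hfg⟩ := mem_iUnion₂.1 (hcover hf)
  have hsplit (ρ : Cabv K T X) (hρ : ρ ∈ varBall K T X a) :
      ‖sesqIntegral K f ρ - sesqIntegral K g ρ‖ ≤ r / 4 := by
    have h1 := norm_sesqIntegral_le_of_mem_varBall ha hρ (f - g)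
    have h2 : sesqIntegral K (f - g : C(T, X)) (ρ : VectorMeasure T X) =
        sesqIntegral K f ρ - sesqIntegral K g ρ :=
      sesqIntegral_sub (integrable_continuousMap f _) (integrable_continuousMap g _)
    rw [h2, ← dist_eq_norm f g] at h1
    refine h1.trans ?_
    calc dist f g * a ≤ δ * (a + 1) := by
          gcongr
          · exact (Metric.mem_ball.1 hfg).le
          · linarith
      _ = r / 4 := by
          simp only [δ]
          field_simp
  have hle : ‖sesqIntegral K f ν.1 - sesqIntegral K f μ.1‖ ≤ r := by
    have e : sesqIntegral K f ν.1 - sesqIntegral K f μ.1 =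
        (sesqIntegral K f ν.1 - sesqIntegral K g ν.1) +
          (sesqIntegral K g ν.1 - sesqIntegral K g μ.1) -
          (sesqIntegral K f μ.1 - sesqIntegral K g μ.1) := by ring
    rw [e]
    refine (norm_sub_le _ _).trans ((add_le_add_left (norm_add_le _ _) _).trans ?_)
    linarith [hsplit ν.1 (hA ν.2), hsplit μ.1 (hA μ.2), hν g hg]
  rw [sesqIntegral_coe_sub, ← ofReal_norm, ← ENNReal.ofReal_coe_nnreal]
  exact ENNReal.ofReal_le_ofReal hle

/-- A metric dominated by a multiple of `d_MK` metrizes the weak* topology of a weak* compact set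
of measures. -/
theorem isCompactMetricFor_of_le_mul_dMK [ProperSpace X] {a : ℝ} (ha : 0 ≤ a)
    {A : Set (Cabv K T X)} (hA : A ⊆ varBall K T X a) (hcpt : @IsCompact _ (weakStar K T X) A)
    {d : A → A → ℝ≥0∞} (hd : IsMetric d) {C : ℝ≥0∞} (hC : C ≠ ∞)
    (hdC : ∀ μ ν, d μ ν ≤ dMK K A μ ν * C) : IsCompactMetricFor (weakStarOn K A) d := by
  obtain ⟨m, hm⟩ := hd
  have hcompact : @CompactSpace A (weakStarOn K A) :=
    (@isCompact_iff_compactSpace _ (weakStar K T X) A).1 hcpt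
  have hcont : @Continuous A A (weakStarOn K A) m.toUniformSpace.toTopologicalSpace id := by
    refine (@continuous_iff_continuousAt _ _ (weakStarOn K A) _ _).2 fun μ => ?_
    refine EMetric.tendsto_nhds.2 fun ε hε => ?_
    obtain ⟨η, hη0, hη⟩ := exists_between hε
    -- For `C = 0` the radius η/C is ∞, and C · (η/C) ≤ η still holds.
    filter_upwards [eventually_mkNorm_sub_lt ha hA μ
      (ENNReal.div_pos hη0.ne' hC)] with ν hν
    refine lt_of_le_of_lt ?_ hη
    rw [id, id]
    refine (hm ν μ).trans_le ((hdC ν μ).trans ((mul_le_mul_left hν C).trans ?_))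
    rw [mul_comm]
    exact ENNReal.mul_div_le
  have hind := @eq_induced_of_continuous_injective A A (weakStarOn K A)
    m.toUniformSpace.toTopologicalSpace hcompact _ id hcont Function.injective_id
  rw [induced_id] at hind
  have hc : CompactSpace A := hind ▸ hcompact
  exact ⟨m, hm, hc, inferInstance, hind.symm⟩

/-- Stated for proper `X` so that it covers both Kⁿ and ℝ. -/
theorem isCompactMetricFor_varBallMass [Nonempty T] [ProperSpace X] [CompleteSpace X] {a : ℝ}
    (ha : 0 ≤ a) (v : X) :
    IsCompactMetricFor (weakStarOn K (varBallMass K T a v)) (dMK K (varBallMass K T a v)) ∧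
    IsCompactMetricFor (weakStarOn K (varBallMass K T a v)) (dMKStar K (varBallMass K T a v)) :=
  ⟨isCompactMetricFor_of_le_mul_dMK ha (fun _ h => h.1) (isCompact_varBallMass ha v)
      (isMetric_dMK _) ENNReal.one_ne_top fun _ _ => (mul_one _).ge,
    isCompactMetricFor_of_le_mul_dMK ha (fun _ h => h.1) (isCompact_varBallMass ha v)
      (isMetric_dMKStar a v) (by simp [ediam_univ_ne_top]) dMKStar_le_dMK_mul⟩

end FiniteDimensional

/-! ### Nonnegative real measures and probabilities. -/

section Nonnegative

variable {T : Type*} [MetricSpace T] [MeasurableSpace T]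

theorem exists_toSignedMeasure_eq {μ : SignedMeasure T}
    (hμ : ∀ s, MeasurableSet s → 0 ≤ μ s) :
    ∃ m : Measure T, ∃ _ : IsFiniteMeasure m, m.toSignedMeasure = μ := by
  have h : 0 ≤[univ] μ := (VectorMeasure.le_restrict_univ_iff_le _ _).2 fun s hs => hμ s hs
  exact ⟨_, inferInstance, SignedMeasure.toMeasureOfZeroLE_toSignedMeasure μ h⟩

theorem variation_univ_of_nonneg {μ : SignedMeasure T} (hμ : ∀ s, MeasurableSet s → 0 ≤ μ s) :
    μ.variation univ = ENNReal.ofReal (μ univ) := by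
  obtain ⟨m, hm, rfl⟩ := exists_toSignedMeasure_eq hμ
  rw [Measure.variation_toSignedMeasure, Measure.toSignedMeasure_apply_measurable .univ,
    ofReal_measureReal]

/-- |μ(s)| + |μ(sᶜ)| ≤ |μ|(T) ≤ μ(T) = μ(s) + μ(sᶜ) leaves no room for a negative value. -/
theorem nonneg_of_variation_univ_le {μ : SignedMeasure T}
    (hμ : μ.variation univ ≤ ENNReal.ofReal (μ univ)) (h0 : 0 ≤ μ univ) {s : Set T}
    (hs : MeasurableSet s) : 0 ≤ μ s := by
  have hfin : IsFiniteMeasure μ.variation := ⟨hμ.trans_lt ENNReal.ofReal_lt_top⟩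
  have h1 : μ.variation.real univ ≤ μ univ := ENNReal.toReal_le_of_le_ofReal h0 hμ
  have h2 : μ s + μ sᶜ = μ univ := by
    rw [VectorMeasure.of_compl hs, add_sub_cancel]
  have h3 := measureReal_add_measureReal_compl (μ := μ.variation) hs
  have h4 := VectorMeasure.norm_measure_le_variation (μ := μ) (E := s)
  have h5 := VectorMeasure.norm_measure_le_variation (μ := μ) (E := sᶜ)
  have h6 := neg_le_abs (μ s)
  have h7 := le_abs_self (μ sᶜ)
  rw [Real.norm_eq_abs] at h4 h5
  linarith [measureReal_nonneg (μ := μ.variation) (s := s)]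

/-- Given mass v, positivity amounts to the smallest possible variation, so the nonnegative case
becomes an instance of the signed one with radius v. -/
theorem varBallMassPos_eq {a v : ℝ} (hv : 0 ≤ v) (hva : v ≤ a) :
    varBallMassPos T a v = varBallMass ℝ T v v := by
  ext μ
  constructor
  · rintro ⟨⟨-, h⟩, hpos⟩
    refine ⟨?_, h⟩
    have := variation_univ_of_nonneg hpos
    rw [h] at this
    exact this.le
  · rintro ⟨hle, h⟩
    refine ⟨⟨le_trans hle (ENNReal.ofReal_le_ofReal hva), h⟩, fun s hs => ?_⟩
    refine nonneg_of_variation_univ_le ?_ (hv.trans_eq h.symm) hs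
    rw [h]
    exact hle

theorem image_varBallMassPos_one :
    (fun μ : Cabv ℝ T ℝ => (μ : VectorMeasure T ℝ)) '' varBallMassPos T 1 1 =
      range fun P : ProbabilityMeasure T => (P : Measure T).toSignedMeasure := by
  ext μ
  constructor
  · rintro ⟨μ, ⟨⟨-, h⟩, hpos⟩, rfl⟩
    obtain ⟨m, hm, hmμ⟩ := exists_toSignedMeasure_eq hpos
    refine ⟨⟨m, ⟨?_⟩⟩, hmμ⟩
    rw [← hmμ, Measure.toSignedMeasure_apply_measurable .univ] at h
    rw [← ofReal_measureReal, h, ENNReal.ofReal_one]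
  · rintro ⟨P, rfl⟩
    have hvar : (P : Measure T).toSignedMeasure.variation univ = 1 := by simp
    refine ⟨⟨(P : Measure T).toSignedMeasure, hvar.trans_lt ENNReal.one_lt_top⟩,
      ⟨⟨?_, ?_⟩, fun s hs => ?_⟩, rfl⟩
    · exact hvar.trans_le ENNReal.ofReal_one.ge
    · simp
    · rw [Measure.toSignedMeasure_apply_measurable hs]
      exact measureReal_nonneg

end Nonnegative
end VectorMK

theorem theorem20 {K : Type*} [RCLike K]
    {T : Type*} [MetricSpace T] [CompactSpace T] [Nontrivial T] [MeasurableSpace T] [BorelSpace T]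
    {X : Type*} [NormedAddCommGroup X] [InnerProductSpace K X] [CompleteSpace X] [Nontrivial X]
    (a : ℝ) (ha : 0 < a) :
    -- 1. arbitrary Hilbert space
    (∀ v : X, ‖v‖ ≤ a →
      (VectorMK.varBallMass K T a v).Nonempty ∧
      @IsClosed (VectorMK.varBall K T X a) (VectorMK.weakStarOn K (VectorMK.varBall K T X a))
        (Subtype.val ⁻¹' VectorMK.varBallMass K T a v) ∧
      @IsClosed (VectorMK.Cabv K T X) (VectorMK.weakStar K T X) (VectorMK.varBallMass K T a v) ∧
      @IsCompact (VectorMK.Cabv K T X) (VectorMK.weakStar K T X) (VectorMK.varBallMass K T a v) ∧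
      VectorMK.IsMetric (VectorMK.dMK K (VectorMK.varBallMass K T a v)) ∧
      VectorMK.IsMetric (VectorMK.dMKStar K (VectorMK.varBallMass K T a v)) ∧
      ∀ μ ν : VectorMK.varBallMass K T a v,
        VectorMK.dMK K _ μ ν ≤ VectorMK.dMKStar K _ μ ν ∧
        VectorMK.dMKStar K _ μ ν ≤
          VectorMK.dMK K _ μ ν * (Metric.ediam (Set.univ : Set T) + 1)) ∧
    -- 2. the space `K ^ n`
    (∀ n : ℕ, 1 ≤ n → ∀ v : EuclideanSpace K (Fin n), ‖v‖ ≤ a →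
      VectorMK.IsCompactMetricFor (VectorMK.weakStarOn K (VectorMK.varBallMass K T a v))
        (VectorMK.dMK K (VectorMK.varBallMass K T a v)) ∧
      VectorMK.IsCompactMetricFor (VectorMK.weakStarOn K (VectorMK.varBallMass K T a v))
        (VectorMK.dMKStar K (VectorMK.varBallMass K T a v))) ∧
    -- 3. nonnegative real measures
    (∀ v : ℝ, 0 ≤ v → v ≤ a →
      VectorMK.IsCompactMetricFor (VectorMK.weakStarOn ℝ (VectorMK.varBallMassPos T a v))
        (VectorMK.dMK ℝ (VectorMK.varBallMassPos T a v)) ∧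
      VectorMK.IsCompactMetricFor (VectorMK.weakStarOn ℝ (VectorMK.varBallMassPos T a v))
        (VectorMK.dMKStar ℝ (VectorMK.varBallMassPos T a v))) ∧
    -- the case `a = v = 1` of 3. consists of all the probabilities
    (fun μ : VectorMK.Cabv ℝ T ℝ => (μ : MeasureTheory.VectorMeasure T ℝ)) ''
        VectorMK.varBallMassPos T 1 1 =
      Set.range (fun P : MeasureTheory.ProbabilityMeasure T =>
        (P : MeasureTheory.Measure T).toSignedMeasure) := by
  refine ⟨fun v hv => ⟨VectorMK.varBallMass_nonempty hv, ?_, VectorMK.isClosed_varBallMass ha.le v,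
    VectorMK.isCompact_varBallMass ha.le v, VectorMK.isMetric_dMK _, VectorMK.isMetric_dMKStar a v,
    fun μ ν => ⟨VectorMK.dMK_le_dMKStar _ μ ν, VectorMK.dMKStar_le_dMK_mul μ ν⟩⟩,
    fun n _ v _ => ?_, fun v hv hva => ?_, VectorMK.image_varBallMassPos_one⟩
  · let _ := VectorMK.weakStar K T X
    exact (VectorMK.isClosed_varBallMass ha.le v).preimage continuous_subtype_val
  · exact VectorMK.isCompactMetricFor_varBallMass ha.le v
  · rw [VectorMK.varBallMassPos_eq hv hva]
    -- The radius is now v, possibly 0, which is why the compactness lemmas assume only 0 ≤ a.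
    exact VectorMK.isCompactMetricFor_varBallMass hv v
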